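/- Let $G=(V,E)$ be a finite simple undirected graph whose vertices are players. Consider the following two protocols that share a secret bit $s\in\{0,1\}$ among the players. * **GSS (classical).** Pick independent uniform bits $(k_i)_{i\in V}$ and give player $i$ the pair $(k_i,c_i)$, where $c_i=s+\sum_{j\in\mathcal N(i)}k_j \bmod 2$ and $\mathcal N(i)$ is the neighbourhood of $i$ in $G$. A set $B\subseteq V$ is *authorised* if the secret is a function of the shares of the players in $B$. It is *forbidden* if the joint law of these shares does not depend on $s$. * **GS-QSS (quantum, classical secret).** Let $|G\rangle=2^{-|V|/2}\sum_{x\in\{0,1\}^V}(-1)^{q(x)}|x\rangle$ be the graph state of $G$, where $q(x)$ is the number of edges $\{u,v\}\in E$ with $x_u=x_v=1$. The secret $s$ is encoded as $Z_V^{\,s}|G\rangle$, where $Z_V$ is the Pauli operator $Z$ applied to every qubit, and player $i$ receives the $i$-th qubit. A set $B\subseteq V$ is *authorised* if some measurement (POVM) of the qubits of $B$ outputs $s$ with probability $1$ for both values of $s$. It is *forbidden* if the outcome distribution of every POVM on the qubits of $B$ does not depend on $s$. Then the accessing structures of the two protocols coincide: for every $B\subseteq V$, the set $B$ is authorised in the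 GS-QSS protocol on $G$ if and only if it is authorised in the GSS protocol on $G$, and it is forbidden in the GS-QSS protocol on $G$ if and only if it is forbidden in the GSS protocol on $G$. Consequently, the accessing structure of the GS-QSS protocol on $G$ with a classical secret bit is also that of a purely classical protocol in which each player receives only two bits. -/

import Mathlib

open scoped Matrix ComplexOrder

noncomputable section

namespace GraphSecretSharing

/-- The accessing structure of a secret sharing protocol with player set `V`: which sets of players
are authorised and which are forbidden. -/
@[ext]
structure AccessingStructure (V : Type*) where
  authorised : Set (Finset V)
  forbidden : Set (Finset V)

/-! ### Classical protocols for a secret bit -/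

/-- A classical protocol sharing a secret bit among the players `V`, with shares in `S`: for each
value of the secret, the joint law of the shares handed out to the players. -/
structure ClassicalProtocol (V S : Type*) where
  deal : ZMod 2 → PMF (V → S)

namespace ClassicalProtocol

variable {V S : Type*}

/-- The law of the collection of shares held by the players in `B`, given the secret `s`. -/
def view (P : ClassicalProtocol V S) (B : Finset V) (s : ZMod 2) : PMF (B → S) :=
  (P.deal s).map fun σ i => σ i

/-- The players in `B` can recover the secret from their shares (with certainty). -/
def IsAuthorised (P : ClassicalProtocol V S) (B : Finset V) : Prop :=
  ∃ recover : (B → S) → ZMod 2, ∀ s, ∀ w ∈ (P.view B s).support, recover w = s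

/-- The players in `B` have no information about the secret: the law of what they hold is the same
for both values of the secret. -/
def IsForbidden (P : ClassicalProtocol V S) (B : Finset V) : Prop :=
  P.view B 0 = P.view B 1

def accessingStructure (P : ClassicalProtocol V S) : AccessingStructure V where
  authorised := {B | P.IsAuthorised B}
  forbidden := {B | P.IsForbidden B}

end ClassicalProtocol

/-- The shares `(kᵢ, cᵢ)`, where `cᵢ = s + ∑ kⱼ` over the neighbours `j` of `i`. -/
def gssShares {V : Type*} [Fintype V] (G : SimpleGraph V) [DecidableRel G.Adj]
    (s : ZMod 2) (k : V → ZMod 2) : V → ZMod 2 × ZMod 2 :=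
  fun i => (k i, s + ∑ j ∈ G.neighborFinset i, k j)

/-- The classical graph-based secret sharing protocol: the keys `kᵢ` are independent uniform bits. -/
def gss {V : Type*} [Fintype V] [DecidableEq V] (G : SimpleGraph V) [DecidableRel G.Adj] :
    ClassicalProtocol V (ZMod 2 × ZMod 2) where
  deal s := (PMF.uniformOfFintype (V → ZMod 2)).map (gssShares G s)

/-! ### Quantum protocols for a secret bit, one qubit per player -/

/-- A measurement (POVM) with outcomes in `κ` on the space with orthonormal basis `ι`. -/
structure Measurement (ι κ : Type*) [Fintype ι] [DecidableEq ι] [Fintype κ] where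
  effect : κ → Matrix ι ι ℂ
  posSemidef : ∀ o, (effect o).PosSemidef
  sum_effect : ∑ o, effect o = 1

/-- The probability of the outcome `o` when the state `ρ` is measured. -/
def Measurement.prob {ι κ : Type*} [Fintype ι] [DecidableEq ι] [Fintype κ]
    (M : Measurement ι κ) (ρ : Matrix ι ι ℂ) (o : κ) : ℂ :=
  (M.effect o * ρ).trace

/-- A protocol sharing a classical secret bit by means of a pure state of `V`-indexed qubits, one
qubit per player. Vectors are given by their amplitudes in the computational basis, which is indexed
by the bit strings `V → ZMod 2`. -/
structure QubitProtocol (V : Type*) [Fintype V] [DecidableEq V] where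
  state : ZMod 2 → (V → ZMod 2) → ℂ
  normalised : ∀ s, ∑ x, ‖state s x‖ ^ 2 = 1

section

variable {V : Type*}

/-- The bit string on `V` that is `x` on `B` and `z` outside `B`. -/
def glue [DecidableEq V] (B : Finset V) (x : {i // i ∈ B} → ZMod 2) (z : {i // i ∉ B} → ZMod 2) :
    V → ZMod 2 :=
  fun i => if h : i ∈ B then x ⟨i, h⟩ else z ⟨i, h⟩

/-- The reduced density matrix on the qubits of `B` of the pure state `ψ`, that is, the partial
trace of `|ψ⟩⟨ψ|` over the qubits outside `B`. -/
def reducedState [Fintype V] [DecidableEq V] (ψ : (V → ZMod 2) → ℂ) (B : Finset V) :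
    Matrix (B → ZMod 2) (B → ZMod 2) ℂ :=
  Matrix.of fun x y => ∑ z : {i // i ∉ B} → ZMod 2, ψ (glue B x z) * star (ψ (glue B y z))

end

namespace QubitProtocol

variable {V : Type*} [Fintype V] [DecidableEq V]

/-- The state of the qubits held by the players in `B`, given the secret `s`. -/
def share (P : QubitProtocol V) (B : Finset V) (s : ZMod 2) :
    Matrix (B → ZMod 2) (B → ZMod 2) ℂ :=
  reducedState (P.state s) B

/-- The players in `B` can recover the secret: some measurement of their qubits outputs the secret
with probability one. -/
def IsAuthorised (P : QubitProtocol V) (B : Finset V) : Prop :=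
  ∃ M : Measurement (B → ZMod 2) (ZMod 2), ∀ s, M.prob (P.share B s) s = 1

/-- The players in `B` have no information about the secret: for every measurement of their qubits
the law of the outcome is the same for both values of the secret. -/
def IsForbidden (P : QubitProtocol V) (B : Finset V) : Prop :=
  ∀ (m : ℕ) (M : Measurement (B → ZMod 2) (Fin m)) (o : Fin m),
    M.prob (P.share B 0) o = M.prob (P.share B 1) o

def accessingStructure (P : QubitProtocol V) : AccessingStructure V where
  authorised := {B | P.IsAuthorised B}
  forbidden := {B | P.IsForbidden B}

end QubitProtocol

section

variable {V : Type*} [Fintype V] [DecidableEq V] (G : SimpleGraph V) [DecidableRel G.Adj]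

/-- The number of edges of `G` both of whose ends carry the bit `1` in `x`. -/
def edgeCount (x : V → ZMod 2) : ℕ :=
  (G.edgeFinset.filter fun e => ∀ v ∈ e, x v = 1).card

/-- The graph state `|G⟩`, i.e. the result of applying a controlled-`Z` gate along every edge of `G`
to qubits that are all in the state `(|0⟩ + |1⟩) / √2`. -/
def graphState (x : V → ZMod 2) : ℂ :=
  ((1 / √(2 ^ Fintype.card V) : ℝ) : ℂ) * (-1) ^ edgeCount G x

/-- The encoding of the secret bit `s`: the graph state if `s = 0`, and the graph state with the
Pauli operator `Z` applied to every qubit if `s = 1`. -/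
def encodedState (s : ZMod 2) (x : V → ZMod 2) : ℂ :=
  (∏ i, (-1) ^ (s.val * (x i).val)) * graphState G x

theorem encodedState_normalised (s : ZMod 2) : ∑ x, ‖encodedState G s x‖ ^ 2 = 1 := by
  have h : ∀ x, ‖encodedState G s x‖ ^ 2 = ((2 : ℝ) ^ Fintype.card V)⁻¹ := by
    intro x
    simp only [encodedState, graphState, norm_mul, norm_prod, norm_pow, norm_neg, norm_one,
      one_pow, Finset.prod_const_one, one_mul, mul_one, Complex.norm_real, Real.norm_eq_abs,
      sq_abs, one_div]
    rw [inv_pow, Real.sq_sqrt (by positivity)]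
  simp [h, ZMod.card]

/-- The graph state quantum secret sharing protocol for a classical secret bit. -/
def gsqss : QubitProtocol V where
  state := encodedState G
  normalised := encodedState_normalised G

end

end GraphSecretSharing

end

open scoped Matrix ComplexOrder

noncomputable section

namespace GraphSecretSharing

variable {V : Type*} [Fintype V] (G : SimpleGraph V) [DecidableRel G.Adj]

/-! ### The two combinatorial alternatives for a set of players -/

/-! Let `A` be the adjacency matrix over `ZMod 2`. Linear duality
(`exists_isWitness_or_exists_isCounterwitness`) gives each `B` either an odd set `D ⊆ B` whose odd
neighbourhood lies in `B`, or a set `C` disjoint from `B` whose odd neighbourhood contains `B`. In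
both protocols `D` makes `B` authorised: classically by a linear combination of the shares,
quantumly by measuring the stabiliser of `D`. In both protocols `C` makes `B` forbidden, because
translating the keys, respectively the traced-out basis states, by `C` exchanges the two secrets as
seen from `B`. No set is both authorised and forbidden, so the alternative determines both
structures completely. -/

/-- The parities at which the vertices of the graph see the set with indicator `x`. -/
def oddNeighbours (x : V → ZMod 2) : V → ZMod 2 := G.adjMatrix (ZMod 2) *ᵥ x

theorem oddNeighbours_apply (x : V → ZMod 2) (v : V) :
    oddNeighbours G x v = ∑ u ∈ G.neighborFinset v, x u :=
  G.adjMatrix_mulVec_apply v x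

theorem oddNeighbours_add (x y : V → ZMod 2) :
    oddNeighbours G (x + y) = oddNeighbours G x + oddNeighbours G y :=
  Matrix.mulVec_add _ _ _

theorem dotProduct_oddNeighbours_comm (x y : V → ZMod 2) :
    x ⬝ᵥ oddNeighbours G y = y ⬝ᵥ oddNeighbours G x := by
  rw [oddNeighbours, Matrix.dotProduct_mulVec, ← Matrix.mulVec_transpose,
    SimpleGraph.transpose_adjMatrix, dotProduct_comm, oddNeighbours]

theorem dotProduct_eq_sum_subtype {B : Finset V} {d : V → ZMod 2} (hd : ∀ v ∉ B, d v = 0)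
    (x : V → ZMod 2) : d ⬝ᵥ x = ∑ v : B, d v * x v := by
  rw [Finset.sum_coe_sort B fun v => d v * x v, dotProduct]
  exact (Finset.sum_subset (Finset.subset_univ B) fun v _ hv => by rw [hd v hv, zero_mul]).symm

theorem gssShares_eq (s : ZMod 2) (k : V → ZMod 2) (v : V) :
    gssShares G s k v = (k v, s + oddNeighbours G k v) := by
  rw [oddNeighbours_apply, gssShares]

variable [DecidableEq V]

/-- An odd set of vertices contained in `B` together with its odd neighbourhood, given by its
indicator function. -/
structure IsWitness (B : Finset V) (d : V → ZMod 2) : Prop where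
  eq_zero : ∀ v ∉ B, d v = 0
  oddNeighbours_eq_zero : ∀ v ∉ B, oddNeighbours G d v = 0
  sum_eq_one : ∑ v, d v = 1

/-- A set of vertices disjoint from `B` whose odd neighbourhood contains `B`, given by its
indicator function. -/
structure IsCounterwitness (B : Finset V) (c : V → ZMod 2) : Prop where
  eq_zero : ∀ v ∈ B, c v = 0
  oddNeighbours_eq_one : ∀ v ∈ B, oddNeighbours G c v = 1

/-- The question is whether the all-ones vector lies in the span of the `e_v` and `A e_v` with `v ∉
B`. If so, the `e_v` vanish on `B` and the coefficients of the `A e_v` form `c`. If not, a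
functional separates it from the span; its coefficient vector is `d`. -/
theorem exists_isWitness_or_exists_isCounterwitness (B : Finset V) :
    (∃ d, IsWitness G B d) ∨ ∃ c, IsCounterwitness G B c := by
  by_cases h : (fun _ => 1 : V → ZMod 2) ∈ Submodule.span (ZMod 2)
      {w | ∃ v ∉ B, w = Pi.single v 1 ∨ w = oddNeighbours G (Pi.single v 1)}
  · right
    -- Generalised from the all-ones vector to any `w` in the span, so that span induction applies.
    suffices H : ∀ w ∈ Submodule.span (ZMod 2)
        {w | ∃ v ∉ B, w = Pi.single v 1 ∨ w = oddNeighbours G (Pi.single v 1)},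
        ∃ c : V → ZMod 2, (∀ v ∈ B, c v = 0) ∧ ∀ v ∈ B, oddNeighbours G c v = w v by
      obtain ⟨c, hc, hc'⟩ := H _ h
      exact ⟨c, hc, hc'⟩
    intro w hw
    induction hw using Submodule.span_induction with
    | mem w hw =>
      obtain ⟨v, hv, rfl | rfl⟩ := hw
      · refine ⟨0, by simp, fun u hu => ?_⟩
        have : u ≠ v := fun h => hv (h ▸ hu)
        simp [oddNeighbours, this]
      · refine ⟨Pi.single v 1, fun u hu => ?_, fun _ _ => rfl⟩
        have : u ≠ v := fun h => hv (h ▸ hu)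
        simp [this]
    | zero => exact ⟨0, by simp, by simp [oddNeighbours]⟩
    | add w w' _ _ h h' =>
      obtain ⟨c, h1, h2⟩ := h
      obtain ⟨c', h1', h2'⟩ := h'
      refine ⟨c + c', fun u hu => by simp [h1 u hu, h1' u hu], fun u hu => ?_⟩
      simp [oddNeighbours_add, h2 u hu, h2' u hu]
    | smul a w _ h =>
      obtain ⟨c, h1, h2⟩ := h
      refine ⟨a • c, fun u hu => by simp [h1 u hu], fun u hu => ?_⟩
      rw [oddNeighbours, Matrix.mulVec_smul]
      simp only [Pi.smul_apply]
      rw [← h2 u hu, oddNeighbours]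
  · left
    obtain ⟨f, hf, hle⟩ := Submodule.exists_le_ker_of_notMem h
    have hf' : ∀ w : V → ZMod 2, f w = w ⬝ᵥ fun v => f (Pi.single v 1) := by
      intro w
      rw [f.pi_apply_eq_sum_univ w]
      simp only [dotProduct, smul_eq_mul]
      refine Finset.sum_congr rfl fun v _ => ?_
      congr 2
      ext u
      simp [Pi.single_apply, eq_comm]
    refine ⟨fun v => f (Pi.single v 1), fun v hv => ?_, fun v hv => ?_, ?_⟩
    · exact hle (Submodule.subset_span ⟨v, hv, .inl rfl⟩)
    · have := hle (Submodule.subset_span ⟨v, hv, .inr rfl⟩)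
      -- Symmetry of `A` turns `f (A e_v) = 0` into the vanishing of `A d` at `v`.
      rw [LinearMap.mem_ker, hf', dotProduct_comm, dotProduct_oddNeighbours_comm] at this
      simpa using this
    · rw [hf'] at hf
      simp only [dotProduct, one_mul] at hf
      exact Fin.eq_one_of_ne_zero _ hf

/-! ### The classical protocol -/

theorem ClassicalProtocol.not_isAuthorised_and_isForbidden {V S : Type*}
    (P : ClassicalProtocol V S) (B : Finset V) : ¬(P.IsAuthorised B ∧ P.IsForbidden B) := by
  rintro ⟨⟨r, hr⟩, h⟩
  obtain ⟨w, hw⟩ := (P.view B 0).support_nonempty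
  have h0 := hr 0 w hw
  rw [show P.view B 0 = P.view B 1 from h] at hw
  exact zero_ne_one (h0.symm.trans (hr 1 w hw))

variable {G} in
theorem IsWitness.gss_isAuthorised {B : Finset V} {d : V → ZMod 2} (h : IsWitness G B d) :
    (gss G).IsAuthorised B := by
  -- Summing `c_v` over `D` gives `s · |D| + d ⬝ A k`; since `d ⬝ A k = k ⬝ A d`, the keys in `B`
  -- suffice to remove the second term.
  refine ⟨fun w => ∑ v : B, d v * (w v).2 - ∑ v : B, oddNeighbours G d v * (w v).1, ?_⟩
  intro s w hw
  simp only [ClassicalProtocol.view, gss, PMF.support_map, PMF.support_uniformOfFintype,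
    Set.top_eq_univ, Set.image_univ, Set.mem_image, Set.mem_range] at hw
  obtain ⟨_, ⟨k, rfl⟩, rfl⟩ := hw
  simp only [gssShares_eq]
  rw [← dotProduct_eq_sum_subtype h.eq_zero fun v => s + oddNeighbours G k v,
    ← dotProduct_eq_sum_subtype h.oddNeighbours_eq_zero k]
  have : (fun v => s + oddNeighbours G k v) = (fun _ => s) + oddNeighbours G k := rfl
  rw [this, dotProduct_add, dotProduct_oddNeighbours_comm, dotProduct_comm k, add_sub_cancel_right]
  rw [dotProduct, ← Finset.sum_mul, h.sum_eq_one, one_mul]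

theorem map_uniformOfFintype_equiv {α : Type*} [Fintype α] [Nonempty α] (e : α ≃ α) :
    (PMF.uniformOfFintype α).map e = PMF.uniformOfFintype α := by
  classical
  ext a
  rw [PMF.map_apply, tsum_eq_single (e.symm a)]
  · simp
  · intro b hb
    rw [if_neg]
    rintro rfl
    simp at hb

variable {G} in
-- Adding `c` to the keys preserves their uniform law and leaves the keys in `B` alone, but flips
-- every `c_v` with `v ∈ B`, as changing `s` does.
theorem IsCounterwitness.gss_isForbidden {B : Finset V} {c : V → ZMod 2}
    (h : IsCounterwitness G B c) : (gss G).IsForbidden B := by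
  rw [ClassicalProtocol.IsForbidden, ClassicalProtocol.view, ClassicalProtocol.view]
  simp only [gss]
  conv_rhs => rw [← map_uniformOfFintype_equiv (Equiv.addRight c)]
  simp only [PMF.map_comp]
  congr 1
  ext1 k
  funext v
  have h2 : (1 : ZMod 2) + 1 = 0 := rfl
  simp only [Function.comp, gssShares_eq, Equiv.coe_addRight, oddNeighbours_add, Pi.add_apply,
    h.eq_zero v v.2, h.oddNeighbours_eq_one v v.2, add_zero, zero_add]
  rw [add_comm, add_assoc, h2, add_zero]

/-! ### The amplitudes of the encoded states -/

/-- The nontrivial character of `ZMod 2`. -/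
def sign (a : ZMod 2) : ℂ := (-1) ^ a.val

theorem sign_zero : sign 0 = 1 := by simp [sign]

theorem sign_one : sign 1 = -1 := by simp [sign, ZMod.val_one]

theorem sign_natCast (n : ℕ) : sign n = (-1) ^ n := by
  rw [sign, ZMod.val_natCast, ← neg_one_pow_eq_pow_mod_two]

theorem sign_add (a b : ZMod 2) : sign (a + b) = sign a * sign b := by
  rw [← ZMod.natCast_zmod_val a, ← ZMod.natCast_zmod_val b, ← Nat.cast_add]
  simp only [sign_natCast, pow_add]

theorem sign_sum {ι : Type*} (t : Finset ι) (f : ι → ZMod 2) :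
    sign (∑ i ∈ t, f i) = ∏ i ∈ t, sign (f i) := by
  classical
  induction t using Finset.induction_on with
  | empty => simp [sign_zero]
  | insert a t ha ih => rw [Finset.sum_insert ha, Finset.prod_insert ha, sign_add, ih]

theorem star_sign (a : ZMod 2) : star (sign a) = sign a := by simp [sign]

theorem sign_mul_self (a : ZMod 2) : sign a * sign a = 1 := by
  rw [← sign_add, CharTwo.add_self_eq_zero, sign_zero]

/-! ### The edge parity as a quadratic form -/

/-- The parity of the number of edges with both ends in the set with indicator `x`. -/
def edgeParity (x : V → ZMod 2) : ZMod 2 := edgeCount G x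

theorem add_self_eq_zero {ι : Type*} (x : ι → ZMod 2) : x + x = 0 :=
  funext fun i => CharTwo.add_self_eq_zero (x i)

theorem edgeParity_eq_sum (x : V → ZMod 2) :
    edgeParity G x =
      ∑ e ∈ G.edgeFinset, Sym2.lift ⟨fun u v => x u * x v, fun _ _ => mul_comm _ _⟩ e := by
  rw [edgeParity, edgeCount, Finset.card_filter, Nat.cast_sum]
  refine Finset.sum_congr rfl fun e _ => ?_
  induction e with
  | _ u v =>
    simp only [Sym2.mem_iff, forall_eq_or_imp, forall_eq, Sym2.lift_mk]
    generalize x u = a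
    generalize x v = b
    revert a b
    decide

/-- Each edge comes from exactly two ordered pairs of adjacent vertices. -/
theorem sum_edgeFinset_symmetrised (f : V → V → ZMod 2) :
    ∑ e ∈ G.edgeFinset, Sym2.lift ⟨fun u v => f u v + f v u, fun _ _ => add_comm _ _⟩ e =
      ∑ u, ∑ v ∈ G.neighborFinset u, f u v := by
  have h : ∑ u, ∑ v ∈ G.neighborFinset u, f u v =
      ∑ p : V × V with G.Adj p.1 p.2, f p.1 p.2 := by
    rw [Finset.sum_filter, Fintype.sum_prod_type]
    refine Finset.sum_congr rfl fun u _ => ?_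
    rw [SimpleGraph.neighborFinset_eq_filter, Finset.sum_filter]
  rw [h, ← Finset.sum_fiberwise_of_maps_to (t := G.edgeFinset) (g := fun p : V × V => s(p.1, p.2))
    (by simp)]
  refine Finset.sum_congr rfl fun e he => ?_
  induction e with
  | _ u v =>
    have huv : G.Adj u v := by simpa using he
    have hfib : ({p ∈ ({p : V × V | G.Adj p.1 p.2} : Finset (V × V)) | s(p.1, p.2) = s(u, v)}) =
        {(u, v), (v, u)} := by
      ext ⟨a, b⟩
      simp only [Finset.mem_filter, Finset.mem_univ, true_and, Sym2.eq_iff, Finset.mem_insert,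
        Finset.mem_singleton, Prod.mk.injEq]
      constructor
      · exact fun h => h.2
      · rintro (⟨rfl, rfl⟩ | ⟨rfl, rfl⟩)
        · exact ⟨huv, .inl ⟨rfl, rfl⟩⟩
        · exact ⟨huv.symm, .inr ⟨rfl, rfl⟩⟩
    rw [hfib, Finset.sum_pair (by simp [huv.ne]), Sym2.lift_mk]

/-- Polarisation: expanding `(x u + d u) * (x v + d v)` on each edge leaves the bilinear form of `A`
as cross term. -/
theorem edgeParity_add (x d : V → ZMod 2) :
    edgeParity G (x + d) = edgeParity G x + edgeParity G d + x ⬝ᵥ oddNeighbours G d := by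
  have h : x ⬝ᵥ oddNeighbours G d = ∑ u, ∑ v ∈ G.neighborFinset u, x u * d v := by
    simp only [dotProduct, oddNeighbours_apply, Finset.mul_sum]
  rw [h, ← sum_edgeFinset_symmetrised, edgeParity_eq_sum, edgeParity_eq_sum, edgeParity_eq_sum,
    ← Finset.sum_add_distrib, ← Finset.sum_add_distrib]
  refine Finset.sum_congr rfl fun e _ => ?_
  induction e with
  | _ u v =>
    simp only [Sym2.lift_mk, Pi.add_apply]
    ring

theorem dotProduct_oddNeighbours_self (d : V → ZMod 2) : d ⬝ᵥ oddNeighbours G d = 0 := by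
  have h := edgeParity_add G d d
  have h0 : edgeParity G 0 = 0 := by
    rw [edgeParity_eq_sum]
    exact Finset.sum_eq_zero fun e _ => by
      induction e with
      | _ u v => simp
  rwa [add_self_eq_zero, CharTwo.add_self_eq_zero, h0, zero_add, eq_comm] at h

theorem encodedState_eq (s : ZMod 2) (x : V → ZMod 2) :
    encodedState G s x =
      ((1 / √(2 ^ Fintype.card V) : ℝ) : ℂ) * sign (s * ∑ i, x i + edgeParity G x) := by
  have h : ∏ i, (-1 : ℂ) ^ (s.val * (x i).val) = sign (s * ∑ i, x i) := by
    rw [Finset.mul_sum, sign_sum]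
    refine Finset.prod_congr rfl fun i _ => ?_
    rw [← sign_natCast, Nat.cast_mul, ZMod.natCast_zmod_val, ZMod.natCast_zmod_val]
  rw [encodedState, graphState, h, sign_add, edgeParity, sign_natCast]
  ring

theorem encodedState_add (s : ZMod 2) (x d : V → ZMod 2) :
    encodedState G s (x + d) =
      sign (s * ∑ i, d i + edgeParity G d + x ⬝ᵥ oddNeighbours G d) * encodedState G s x := by
  rw [encodedState_eq, encodedState_eq, mul_left_comm, ← sign_add, edgeParity_add]
  simp only [Pi.add_apply, Finset.sum_add_distrib]
  congr 2
  ring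

theorem encodedState_one_eq (x : V → ZMod 2) :
    encodedState G 1 x = sign (∑ i, x i) * encodedState G 0 x := by
  rw [encodedState_eq, encodedState_eq, mul_left_comm, ← sign_add, one_mul, zero_mul, zero_add]

/-! ### Reduced states -/

theorem glue_add {W : Type*} [DecidableEq W] (B : Finset W) (x d : {i // i ∈ B} → ZMod 2) (z c : {i // i ∉ B} → ZMod 2) :
    glue B (x + d) (z + c) = glue B x z + glue B d c := by
  ext v
  by_cases h : v ∈ B <;> simp [glue, h]

theorem sum_glue {M : Type*} [AddCommMonoid M] (B : Finset V) (f : (V → ZMod 2) → M) :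
    ∑ x, ∑ z, f (glue B x z) = ∑ y, f y := by
  rw [← Fintype.sum_prod_type']
  exact (Equiv.piEquivPiSubtypeProd (· ∈ B) fun _ => ZMod 2).symm.sum_comp f

theorem trace_reducedState (ψ : (V → ZMod 2) → ℂ) (B : Finset V) :
    (reducedState ψ B).trace = ((∑ x, ‖ψ x‖ ^ 2 : ℝ) : ℂ) := by
  simp only [Matrix.trace, Matrix.diag, reducedState, Matrix.of_apply]
  rw [sum_glue B fun y => ψ y * star (ψ y)]
  push_cast
  exact Finset.sum_congr rfl fun x _ => Complex.mul_conj' _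

theorem Measurement.sum_prob {ι κ : Type*} [Fintype ι] [DecidableEq ι] [Fintype κ]
    (M : Measurement ι κ) (ρ : Matrix ι ι ℂ) : ∑ o, M.prob ρ o = ρ.trace := by
  simp only [Measurement.prob]
  rw [← Matrix.trace_sum, ← Finset.sum_mul, M.sum_effect, one_mul]

theorem QubitProtocol.not_isAuthorised_and_isForbidden (P : QubitProtocol V) (B : Finset V) :
    ¬(P.IsAuthorised B ∧ P.IsForbidden B) := by
  rintro ⟨⟨M, hM⟩, h⟩
  -- `ZMod 2` unfolds to `Fin 2`, so `M` is itself one of the measurements quantified over in `h`.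
  -- Both outcomes then have probability one under secret `1`, against total trace one.
  have h0 : M.prob (P.share B 1) 0 = 1 := (h 2 M 0).symm.trans (hM 0)
  have h1 := M.sum_prob (P.share B 1)
  rw [QubitProtocol.share, trace_reducedState, P.normalised, ← QubitProtocol.share] at h1
  have h2 : ∑ o, M.prob (P.share B 1) o =
      M.prob (P.share B 1) 0 + M.prob (P.share B 1) 1 := Fin.sum_univ_two _
  rw [h2, h0, hM 1] at h1
  norm_num at h1

variable {G} in
theorem IsCounterwitness.gsqss_isForbidden {B : Finset V} {c : V → ZMod 2}
    (h : IsCounterwitness G B c) : (gsqss G).IsForbidden B := by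
  suffices H : (gsqss G).share B 0 = (gsqss G).share B 1 from fun m M o => by rw [H]
  set c' : {i // i ∉ B} → ZMod 2 := fun v => c v with hc'
  have hglue : ∀ x z, glue B x (z + c') = glue B x z + c := by
    intro x z
    have hc : glue B 0 c' = c := by
      ext v
      by_cases hv : v ∈ B <;> simp [glue, hv, h.eq_zero, hc']
    rw [← hc, ← glue_add, add_zero]
  -- The sign depends on `z` only, so it cancels in each term of the partial trace.
  have key : ∀ z, ∃ a : ZMod 2, ∀ x,
      encodedState G 1 (glue B x z) = sign a * encodedState G 0 (glue B x (z + c')) := by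
    intro z
    refine ⟨glue B 0 z ⬝ᵥ oddNeighbours G c + edgeParity G c + ∑ v, glue B 0 z v, fun x => ?_⟩
    have hx : glue B x z = glue B x 0 + glue B 0 z := by
      rw [← glue_add, add_zero, zero_add]
    -- This is where `A c = 1` on `B` enters: the sign from translating by `c` absorbs the
    -- `x`-dependent part of the `Z` signs.
    have hB : glue B x 0 ⬝ᵥ oddNeighbours G c = ∑ v, glue B x 0 v := by
      refine Finset.sum_congr rfl fun v _ => ?_
      by_cases hv : v ∈ B
      · rw [h.oddNeighbours_eq_one v hv, mul_one]
      · simp [glue, hv]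
    rw [encodedState_one_eq, hglue, encodedState_add, ← mul_assoc, ← sign_add, zero_mul, zero_add]
    congr 2
    conv_lhs => rw [hx]
    conv_rhs => rw [hx, add_dotProduct, hB]
    simp only [Pi.add_apply, Finset.sum_add_distrib]
    have h2 : (2 : ZMod 2) = 0 := rfl
    linear_combination (-(glue B 0 z ⬝ᵥ oddNeighbours G c) - edgeParity G c) * h2
  ext x y
  simp only [QubitProtocol.share, reducedState, Matrix.of_apply, gsqss]
  rw [← Equiv.sum_comp (Equiv.addRight c')]
  refine Finset.sum_congr rfl fun z _ => ?_
  obtain ⟨a, ha⟩ := key z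
  rw [ha, ha, star_mul', star_sign, mul_mul_mul_comm, sign_mul_self, one_mul, Equiv.coe_addRight]

/-! ### The stabiliser measurement of a witness -/

/-- The stabiliser of the graph state associated with `d`, as an operator on the qubits of `B`. -/
def stabiliser (B : Finset V) (d : V → ZMod 2) : Matrix (B → ZMod 2) (B → ZMod 2) ℂ :=
  Matrix.of fun x y =>
    if y = x + (fun v : B => d v) then
      sign (edgeParity G d + ∑ v : B, oddNeighbours G d v * x v) else 0

theorem stabiliser_mul_apply (B : Finset V) (d : V → ZMod 2)
    (ρ : Matrix (B → ZMod 2) (B → ZMod 2) ℂ) (x y : B → ZMod 2) :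
    (stabiliser G B d * ρ) x y =
      sign (edgeParity G d + ∑ v : B, oddNeighbours G d v * x v) * ρ (x + fun v : B => d v) y := by
  simp [Matrix.mul_apply, stabiliser]

section

variable {G} {B : Finset V} {d : V → ZMod 2}

theorem IsWitness.sum_oddNeighbours_mul (h : IsWitness G B d) :
    ∑ v : B, oddNeighbours G d v * d v = 0 := by
  rw [← dotProduct_eq_sum_subtype h.oddNeighbours_eq_zero, dotProduct_comm,
    dotProduct_oddNeighbours_self]

theorem IsWitness.sum_oddNeighbours_mul_add (h : IsWitness G B d) (x : B → ZMod 2) :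
    ∑ v : B, oddNeighbours G d v * (x + fun v : B => d v) v =
      ∑ v : B, oddNeighbours G d v * x v := by
  simp only [Pi.add_apply, mul_add, Finset.sum_add_distrib]
  rw [h.sum_oddNeighbours_mul, add_zero]

/-- The two translations by `d` cancel, and so do the signs, because `d ⬝ A d = 0`. -/
theorem IsWitness.stabiliser_mul_self (h : IsWitness G B d) :
    stabiliser G B d * stabiliser G B d = 1 := by
  ext x y
  have hx : x + (fun v : B => d v) + (fun v : B => d v) = x := by
    rw [add_assoc, add_self_eq_zero, add_zero]
  rw [stabiliser_mul_apply, stabiliser, Matrix.of_apply, h.sum_oddNeighbours_mul_add, hx,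
    Matrix.one_apply, mul_ite, sign_mul_self, mul_zero]
  simp only [eq_comm]

theorem IsWitness.isHermitian_stabiliser (h : IsWitness G B d) :
    (stabiliser G B d).IsHermitian := by
  ext x y
  rw [Matrix.conjTranspose_apply, stabiliser, Matrix.of_apply, Matrix.of_apply]
  by_cases hy : y = x + fun v : B => d v
  · have hx : x = y + fun v : B => d v := by
      rw [hy, add_assoc, add_self_eq_zero, add_zero]
    rw [if_pos hx, if_pos hy, star_sign, hy, h.sum_oddNeighbours_mul_add]
  · have hx : ¬x = y + fun v : B => d v := by
      rintro rfl
      exact hy (by rw [add_assoc, add_self_eq_zero, add_zero])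
    rw [if_neg hx, if_neg hy, star_zero]

/-- Translation by `d` yields the sign of `s · |D| + edgeParity G d + x ⬝ A d`. The stabiliser's own
sign cancels the last two terms, and `|D|` is odd. -/
theorem IsWitness.stabiliser_mul_share (h : IsWitness G B d) (s : ZMod 2) :
    stabiliser G B d * (gsqss G).share B s = sign s • (gsqss G).share B s := by
  ext x y
  rw [stabiliser_mul_apply, Matrix.smul_apply, smul_eq_mul]
  simp only [QubitProtocol.share, reducedState, Matrix.of_apply, gsqss, Finset.mul_sum]
  refine Finset.sum_congr rfl fun z _ => ?_
  have hd : glue B (fun v => d v) 0 = d := by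
    ext v
    by_cases hv : v ∈ B <;> simp [glue, hv, h.eq_zero]
  have hglue : glue B (x + fun v : B => d v) z = glue B x z + d := by
    conv_rhs => rw [← hd, ← glue_add, add_zero]
  have hdot : glue B x z ⬝ᵥ oddNeighbours G d = ∑ v : B, oddNeighbours G d v * x v := by
    rw [dotProduct_comm, dotProduct_eq_sum_subtype h.oddNeighbours_eq_zero]
    simp [glue]
  rw [hglue, encodedState_add, hdot, h.sum_eq_one, mul_one, ← mul_assoc, ← mul_assoc, ← sign_add,
    ← mul_assoc]
  congr 3
  have h2 : (2 : ZMod 2) = 0 := rfl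
  linear_combination (edgeParity G d + ∑ v : B, oddNeighbours G d v * x v) * h2

/-- The projective measurement onto the two eigenspaces of a Hermitian involution. -/
def involutionMeasurement {ι : Type*} [Fintype ι] [DecidableEq ι] (S : Matrix ι ι ℂ)
    (hS : S.IsHermitian) (hS' : S * S = 1) : Measurement ι (ZMod 2) where
  effect o := (1 / 2 : ℂ) • (1 + sign o • S)
  posSemidef o := by
    have hE : ((1 / 2 : ℂ) • (1 + sign o • S)).IsHermitian := by
      rw [Matrix.IsHermitian, Matrix.conjTranspose_smul, Matrix.conjTranspose_add,
        Matrix.conjTranspose_smul, hS.eq, star_sign, Matrix.conjTranspose_one]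
      simp
    -- The effect is a Hermitian idempotent `E`, so `E = Eᴴ * E` is positive semidefinite.
    have hE' : ((1 / 2 : ℂ) • (1 + sign o • S)) * ((1 / 2 : ℂ) • (1 + sign o • S)) =
        (1 / 2 : ℂ) • (1 + sign o • S) := by
      have hsq : (sign o • S) * (sign o • S) = 1 := by
        rw [smul_mul_smul_comm, sign_mul_self, hS', one_smul]
      rw [smul_mul_smul_comm, add_mul, mul_add, mul_add, hsq, one_mul, one_mul, mul_one]
      module
    have := Matrix.posSemidef_conjTranspose_mul_self ((1 / 2 : ℂ) • (1 + sign o • S))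
    rwa [hE.eq, hE'] at this
  sum_effect := by
    have h : ∀ f : ZMod 2 → Matrix ι ι ℂ, ∑ o, f o = f 0 + f 1 := fun f => Fin.sum_univ_two f
    rw [h, sign_zero, sign_one]
    module

theorem IsWitness.gsqss_isAuthorised (h : IsWitness G B d) : (gsqss G).IsAuthorised B := by
  refine ⟨involutionMeasurement _ h.isHermitian_stabiliser h.stabiliser_mul_self, fun s => ?_⟩
  -- The projector for outcome `s` fixes the share of secret `s`, so the probability is its trace.
  have hs : (1 / 2 : ℂ) • (1 + sign s • stabiliser G B d) * (gsqss G).share B s =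
      (gsqss G).share B s := by
    rw [smul_mul_assoc, add_mul, smul_mul_assoc, h.stabiliser_mul_share, smul_smul, sign_mul_self,
      one_mul]
    module
  rw [Measurement.prob, involutionMeasurement, hs, QubitProtocol.share, trace_reducedState,
    QubitProtocol.normalised, Complex.ofReal_one]

end

theorem gsqss_accessingStructure_eq :
    (gsqss G).accessingStructure = (gss G).accessingStructure := by
  have hQ := (gsqss G).not_isAuthorised_and_isForbidden
  have hC := (gss G).not_isAuthorised_and_isForbidden
  ext B
  · change (gsqss G).IsAuthorised B ↔ (gss G).IsAuthorised B
    obtain ⟨d, hd⟩ | ⟨c, hc⟩ := exists_isWitness_or_exists_isCounterwitness G B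
    · exact iff_of_true hd.gsqss_isAuthorised hd.gss_isAuthorised
    · exact iff_of_false (fun h => hQ B ⟨h, hc.gsqss_isForbidden⟩)
        fun h => hC B ⟨h, hc.gss_isForbidden⟩
  · change (gsqss G).IsForbidden B ↔ (gss G).IsForbidden B
    obtain ⟨d, hd⟩ | ⟨c, hc⟩ := exists_isWitness_or_exists_isCounterwitness G B
    · exact iff_of_false (fun h => hQ B ⟨hd.gsqss_isAuthorised, h⟩)
        fun h => hC B ⟨hd.gss_isAuthorised, h⟩
    · exact iff_of_true hc.gsqss_isForbidden hc.gss_isForbidden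

end GraphSecretSharing

end

theorem mainTheorem3 {V : Type*} [Fintype V] [DecidableEq V]
    (G : SimpleGraph V) [DecidableRel G.Adj] :
    (GraphSecretSharing.gsqss G).accessingStructure =
        (GraphSecretSharing.gss G).accessingStructure ∧
      ∃ P : GraphSecretSharing.ClassicalProtocol V (ZMod 2 × ZMod 2),
        P.accessingStructure = (GraphSecretSharing.gsqss G).accessingStructure :=
  ⟨GraphSecretSharing.gsqss_accessingStructure_eq G, GraphSecretSharing.gss G,
    (GraphSecretSharing.gsqss_accessingStructure_eq G).symm⟩
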